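/- Let $(\Omega,\mathcal F,\mathbb P)$ be an atomless probability space and let $N\ge 2$ be the number of units of a group. Equalities and inequalities between random variables hold $\mathbb P$-a.s., and a probability measure $\mathbb Q\ll\mathbb P$ is identified with its density in $L^1(\mathbb P)$. A map $\rho\colon L^\infty(\mathbb P)\to\mathbb R$ is a *coherent risk measure* if (1) $\xi\ge 0$ implies $\rho(\xi)\le 0$; (2) $\rho$ is convex; (3) $\rho(\xi+a)=\rho(\xi)-a$ for $a\in\mathbb R$; (4) $\rho(\lambda\xi)=\lambda\rho(\xi)$ for $\lambda\ge 0$; (5) $\xi_n\downarrow\xi$ in $L^\infty$ (a.s.) implies $\rho(\xi_n)\uparrow\rho(\xi)$. Its *scenario set* is the nonempty convex closed set $\mathcal S\subset L^1(\mathbb P)$ of probability measures $\mathbb Q\ll\mathbb P$ such that $\rho(\xi)=\sup_{\mathbb Q\in\mathcal S}\mathbb E_{\mathbb Q}[-\xi]$ for all $\xi\in L^\infty$. The risk measure $\rho$ is *commonotonic* if $\rho(\xi+\eta)=\rho(\xi)+\rho(\eta)$ whenever $\xi=f(\zeta)$ and $\eta=g(\zeta)$ for some real random variable $\zeta$ and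 nondecreasing functions $f,g\colon\mathbb R\to\mathbb R$. For a vector $X=(X_1,\dots,X_N)$ of nonnegative bounded random variables and $m\ge 0$, let $\mathbb A^X(m)$ be the set of vectors $Y=(Y_1,\dots,Y_N)$ of nonnegative bounded random variables with $\sum_{i=1}^N Y_i=m$ such that, for every $k$, $Y_k=\frac{X_k}{\sum_i X_i}\,m$ on $\{\sum_i X_i>m\}$ and $Y_k\ge X_k$ on $\{\sum_i X_i\le m\}$. A coherent risk measure $\rho$ is *cohesive* if for every vector $X=(X_1,\dots,X_N)$ of nonnegative bounded random variables there is $Y\in\mathbb A^X\bigl(\rho(-\sum_{i=1}^N X_i)\bigr)$ with $\rho(Y_i-X_i)\le 0$ for all $i\in\{1,\dots,N\}$. **Proposition.** Let $\rho$ be a commonotonic coherent risk measure whose scenario set is weakly compact in $L^1(\mathbb P)$. Then $\rho$ is cohesive if and only if there is $H\in L^1(\mathbb P)$ with $H\ge 0$ and $\mathbb E_{\mathbb P}[H]\ge 1$ such that $\rho=\rho^H$, where, for $\xi\in L^\infty(\mathbb P)$, $$\rho^H(\xi)=\sup\Bigl\{\mathbb E_{\mathbb Q}[-\xi] \;:\;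 \mathbb Q \text{ a probability measure},\ \mathbb Q\ll\mathbb P,\ 0\le \tfrac{d\mathbb Q}{d\mathbb P}\le H\Bigr\}.$$ -/

import Mathlib

open MeasureTheory Filter Topology
open scoped ENNReal

noncomputable section

namespace CohesiveRisk

variable {Ω : Type*} [MeasurableSpace Ω]

/-- `P` has no atoms: every event of positive probability contains an event of strictly smaller,
but still positive, probability. (This is stronger than asking that points are null.) -/
def Atomless (P : Measure Ω) : Prop :=
  ∀ A : Set Ω, MeasurableSet A → 0 < P A →
    ∃ B : Set Ω, MeasurableSet B ∧ B ⊆ A ∧ 0 < P B ∧ P B < P A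

variable (P : Measure Ω) [IsProbabilityMeasure P]

/-- Coherent risk measures on `L^∞(P)`, with the Fatou property. In `fatou` the limit of
`ρ (ξ n)` is an increasing one because `ρ` is automatically monotone decreasing. -/
structure IsCoherent (ρ : Lp ℝ ∞ P → ℝ) : Prop where
  nonpos_of_nonneg : ∀ ξ : Lp ℝ ∞ P, 0 ≤ ξ → ρ ξ ≤ 0
  convex : ∀ (ξ η : Lp ℝ ∞ P) (l : ℝ), 0 ≤ l → l ≤ 1 →
    ρ (l • ξ + (1 - l) • η) ≤ l * ρ ξ + (1 - l) * ρ η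
  cash_additive : ∀ (ξ : Lp ℝ ∞ P) (a : ℝ), ρ (ξ + Lp.const ∞ P a) = ρ ξ - a
  pos_homogeneous : ∀ (ξ : Lp ℝ ∞ P) (l : ℝ), 0 ≤ l → ρ (l • ξ) = l * ρ ξ
  fatou : ∀ (ξ : ℕ → Lp ℝ ∞ P) (η : Lp ℝ ∞ P), Antitone ξ →
    (∀ᵐ ω ∂P, Tendsto (fun n => ξ n ω) atTop (𝓝 (η ω))) →
    Tendsto (fun n => ρ (ξ n)) atTop (𝓝 (ρ η))

/-- Two bounded random variables are commonotonic if, almost surely, both are nondecreasing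
functions of one real random variable. -/
def Commonotonic (ξ η : Lp ℝ ∞ P) : Prop :=
  ∃ (ζ : Ω → ℝ) (f g : ℝ → ℝ), Measurable ζ ∧ Monotone f ∧ Monotone g ∧
    (∀ᵐ ω ∂P, ξ ω = f (ζ ω)) ∧ (∀ᵐ ω ∂P, η ω = g (ζ ω))

/-- A risk measure is commonotonic if it is additive on commonotonic pairs. -/
def IsCommonotonic (ρ : Lp ℝ ∞ P → ℝ) : Prop :=
  ∀ ξ η : Lp ℝ ∞ P, Commonotonic P ξ η → ρ (ξ + η) = ρ ξ + ρ η

/-- The densities `dQ/dP` of the probability measures `Q ≪ P`. Such a `Q` is identified with its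
density, an element of `L^1(P)`. -/
def densities : Set (Lp ℝ 1 P) :=
  {φ | 0 ≤ φ ∧ ∫ ω, φ ω ∂P = 1}

/-- `sup_{Q ∈ S} E_Q[-ξ]` for a set `S` of probability densities. -/
def worstCase (S : Set (Lp ℝ 1 P)) (ξ : Lp ℝ ∞ P) : ℝ :=
  sSup ((fun φ : Lp ℝ 1 P => ∫ ω, φ ω * (-ξ ω) ∂P) '' S)

/-- `S` is the scenario set of `ρ`: the (nonempty) convex, norm closed subset of `L^1(P)`
consisting of probability densities for which `ρ(ξ) = sup_{Q ∈ S} E_Q[-ξ]` for all `ξ`. -/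
structure IsScenarioSet (ρ : Lp ℝ ∞ P → ℝ) (S : Set (Lp ℝ 1 P)) : Prop where
  nonempty : S.Nonempty
  subset_densities : S ⊆ densities P
  convex : Convex ℝ S
  isClosed : IsClosed S
  eq_sup : ∀ ξ : Lp ℝ ∞ P, ρ ξ = worstCase P S ξ

/-- Compactness for the weak topology of the Banach space `L^1(P)`. -/
def IsWeaklyCompact (S : Set (Lp ℝ 1 P)) : Prop :=
  IsCompact (toWeakSpace ℝ (Lp ℝ 1 P) '' S)

/-- The payoff vectors admissible from the total capital `m` for the liability vector `X`. -/
def admissiblePayoffs {N : ℕ} (X : Fin N → Lp ℝ ∞ P) (m : ℝ) : Set (Fin N → Lp ℝ ∞ P) :=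
  {Y | (∀ k, 0 ≤ Y k) ∧ ∑ i, Y i = Lp.const ∞ P m ∧
    ∀ k, ∀ᵐ ω ∂P,
      (m < ∑ i, X i ω → Y k ω = X k ω / (∑ i, X i ω) * m) ∧
      (∑ i, X i ω ≤ m → X k ω ≤ Y k ω)}

/-- The acceptability set of `ρ`. -/
def acceptable (ρ : Lp ℝ ∞ P → ℝ) : Set (Lp ℝ ∞ P) :=
  {ξ | ρ ξ ≤ 0}

/-- A coherent risk measure is cohesive for groups of `N` units if every nonnegative bounded
liability vector `X` has a payoff vector, admissible from the capital `ρ(-∑ X_i)`, which makes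
the net worth `Y_i - X_i` of each unit acceptable. -/
def IsCohesive (N : ℕ) (ρ : Lp ℝ ∞ P → ℝ) : Prop :=
  IsCoherent P ρ ∧
    ∀ X : Fin N → Lp ℝ ∞ P, (∀ i, 0 ≤ X i) →
      ∃ Y ∈ admissiblePayoffs P X (ρ (-∑ i, X i)), ∀ i, Y i - X i ∈ acceptable P ρ

/-- `S^H`, the probabilities `Q` with `0 ≤ dQ/dP ≤ H`. -/
def scenarioSetOf (H : Lp ℝ 1 P) : Set (Lp ℝ 1 P) :=
  {φ | φ ∈ densities P ∧ φ ≤ H}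

/-- The risk measure `ρ^H(ξ) = sup_{Q ∈ S^H} E_Q[-ξ]`. -/
def rhoH (H : Lp ℝ 1 P) : Lp ℝ ∞ P → ℝ :=
  worstCase P (scenarioSetOf P H)

end CohesiveRisk

end

namespace CohesiveRisk

/-! ### Pairings of L¹ with L^∞ and elementary bounds on worst cases. -/

section General

variable {Ω : Type*} [MeasurableSpace Ω] {P : Measure Ω}

/-! Write c(A) = sup_{Q ∈ S} Q(A) = ρ(-1_A). The forward direction shows that c(A) = min(1, ∫_A H)
for an integrable H. Apply cohesiveness to the liabilities 1_A and 1_B of two units, with A, B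
disjoint and m = c(A ∪ B) < 1. In default each unit loses (1 - m) times its claim, so acceptability
forces its gain outside A ∪ B to compensate (1 - m)c(A), respectively (1 - m)c(B); commonotonicity
separates gain from loss. The two gains together are at most m on the complement of A ∪ B, which
yields c(A) + c(B) ≤ c(A ∪ B) (`IsCohesive.capacity_add_le`). Hence c is a measure below any event
with c < 1. Weak compactness and the absence of atoms cover Ω by finitely many such events, and the
densities are glued into H (`Atomless.isTruncatedOn_univ`). The bound c(A) ≤ ∫_A H puts S inside
S^H; conversely, elements of S^H are dominated by c on events, hence by ρ, through layer-cake sums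
and commonotonicity (`IsCommonotonic.integral_mul_neg_le`).

For the converse, let s be the total liability and m = ρ^H(-s). Testing with a density equal to H on
the upper tail of s gives a level c with c + E[H (s - c)⁺] ≤ m. Pay pro rata in default, and
otherwise share the surplus m - s in proportion to the H-weighted default losses; each unit is then
acceptable (`isCohesive_rhoH`). -/

theorem integrable_coe_mul (φ : Lp ℝ 1 P) (ξ : Lp ℝ ∞ P) :
    Integrable (fun ω => φ ω * ξ ω) P :=
  (Lp.memLp φ).integrable_mul (Lp.memLp ξ)

theorem integrable_coe_mul_neg (φ : Lp ℝ 1 P) (ξ : Lp ℝ ∞ P) :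
    Integrable (fun ω => φ ω * (-ξ ω)) P := by
  simpa only [mul_neg, Pi.neg_def] using (integrable_coe_mul φ ξ).neg

theorem ae_abs_le_norm (ξ : Lp ℝ ∞ P) : ∀ᵐ ω ∂P, |ξ ω| ≤ ‖ξ‖ := by
  have h : eLpNorm ξ ∞ P ≠ ∞ := (Lp.memLp ξ).2.ne
  filter_upwards [ae_le_eLpNormEssSup (f := ξ) (μ := P)] with ω hω
  rw [← eLpNorm_exponent_top] at hω
  rw [Lp.norm_def]
  have := ENNReal.toReal_mono h hω
  simpa using this

theorem densities.ae_nonneg {φ : Lp ℝ 1 P} (hφ : φ ∈ densities P) : ∀ᵐ ω ∂P, 0 ≤ φ ω :=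
  (Lp.coeFn_nonneg φ).2 hφ.1

theorem worstCase_le {S : Set (Lp ℝ 1 P)} (hS : S.Nonempty) {ξ : Lp ℝ ∞ P} {c : ℝ}
    (h : ∀ φ ∈ S, ∫ ω, φ ω * (-ξ ω) ∂P ≤ c) : worstCase P S ξ ≤ c :=
  csSup_le (hS.image _) (by rintro _ ⟨φ, hφ, rfl⟩; exact h φ hφ)

theorem scenarioSetOf_subset (H : Lp ℝ 1 P) : scenarioSetOf P H ⊆ densities P := fun _ h => h.1

theorem bddAbove_worstCase {S : Set (Lp ℝ 1 P)} (hS : S ⊆ densities P) (ξ : Lp ℝ ∞ P) :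
    BddAbove ((fun φ : Lp ℝ 1 P => ∫ ω, φ ω * (-ξ ω) ∂P) '' S) := by
  refine ⟨‖ξ‖, ?_⟩
  rintro _ ⟨φ, hφ, rfl⟩
  have h1 : ∫ ω, φ ω * (-ξ ω) ∂P ≤ ∫ ω, φ ω * ‖ξ‖ ∂P := by
    refine integral_mono_ae (integrable_coe_mul_neg φ ξ) ((L1.integrable_coeFn φ).mul_const _) ?_
    filter_upwards [densities.ae_nonneg (hS hφ), ae_abs_le_norm ξ] with ω h0 hb
    exact mul_le_mul_of_nonneg_left ((neg_le_abs _).trans hb) h0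
  rwa [integral_mul_const, (hS hφ).2, one_mul] at h1

theorem le_worstCase {S : Set (Lp ℝ 1 P)} (hS : S ⊆ densities P) {φ : Lp ℝ 1 P} (hφ : φ ∈ S)
    (ξ : Lp ℝ ∞ P) : ∫ ω, φ ω * (-ξ ω) ∂P ≤ worstCase P S ξ :=
  le_csSup (bddAbove_worstCase hS ξ) ⟨φ, hφ, rfl⟩

end General

namespace IsCoherent

variable {Ω : Type*} [MeasurableSpace Ω] {P : Measure Ω} [IsProbabilityMeasure P]
  {ρ : Lp ℝ ∞ P → ℝ}

theorem map_zero (hρ : IsCoherent P ρ) : ρ 0 = 0 := by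
  simpa using hρ.pos_homogeneous 0 0 le_rfl

theorem map_add_le (hρ : IsCoherent P ρ) (ξ η : Lp ℝ ∞ P) : ρ (ξ + η) ≤ ρ ξ + ρ η := by
  have h := hρ.convex ((2 : ℝ) • ξ) ((2 : ℝ) • η) (1 / 2) (by norm_num) (by norm_num)
  rw [hρ.pos_homogeneous _ _ zero_le_two, hρ.pos_homogeneous _ _ zero_le_two, smul_smul,
    smul_smul] at h
  norm_num at h
  linarith

theorem anti (hρ : IsCoherent P ρ) {ξ η : Lp ℝ ∞ P} (h : ξ ≤ η) : ρ η ≤ ρ ξ := by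
  have h1 := hρ.map_add_le ξ (η - ξ)
  have h2 := hρ.nonpos_of_nonneg (η - ξ) (sub_nonneg.2 h)
  rw [add_sub_cancel] at h1
  linarith

end IsCoherent

/-! ### Quantiles and densities on upper tails. -/

section Quantile

variable {Ω : Type*} [MeasurableSpace Ω] {P : Measure Ω}

/-- The upper quantile of `s` at level `1` for the measure with density `h`. -/
theorem exists_quantile {h s : Ω → ℝ} (hint : Integrable h P) (h0 : ∀ᵐ ω ∂P, 0 ≤ h ω)
    (h1 : 1 < ∫ ω, h ω ∂P) (hs : Measurable s) (hs0 : ∀ᵐ ω ∂P, 0 ≤ s ω) {M : ℝ}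
    (hsM : ∀ᵐ ω ∂P, s ω ≤ M) :
    ∃ c : ℝ, ∫ ω in {ω | c < s ω}, h ω ∂P ≤ 1 ∧ 1 ≤ ∫ ω in {ω | c ≤ s ω}, h ω ∂P := by
  set F : ℝ → ℝ := fun c => ∫ ω in {ω | c < s ω}, h ω ∂P with hF
  have hFanti : Antitone F := fun a b hab =>
    setIntegral_mono_set hint.integrableOn (ae_restrict_of_ae h0)
      (Eventually.of_forall fun ω hω => lt_of_le_of_lt hab hω)
  set T : Set ℝ := {c | F c ≤ 1} with hT
  have hne : T.Nonempty := by
    refine ⟨M, ?_⟩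
    have : F M = 0 := by
      refine setIntegral_measure_zero _ ?_
      rw [measure_eq_zero_iff_ae_notMem]
      filter_upwards [hsM] with ω hω
      exact not_lt.2 hω
    rw [hT, Set.mem_ofPred_eq, this]
    exact zero_le_one
  have hbdd : BddBelow T := by
    -- Below level 0 the tail carries the whole mass, which exceeds 1; this is where strictness of
    -- `h1` enters.
    refine ⟨0, fun c hc => ?_⟩
    by_contra! hlt
    have : F c = ∫ ω, h ω ∂P := by
      refine setIntegral_eq_integral_of_ae_compl_eq_zero ?_
      filter_upwards [hs0] with ω hω hn
      exact absurd (hlt.trans_le hω) hn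
    have hc' : F c ≤ 1 := hc
    linarith
  obtain ⟨u, hu, hupos, hulim⟩ := exists_seq_strictAnti_tendsto (0 : ℝ)
  refine ⟨sInf T, ?_, ?_⟩
  -- Continuity from below along levels decreasing to the infimum; each such tail has mass at most
  -- 1.
  · have hU : (⋃ n, {ω | sInf T + u n < s ω}) = {ω | sInf T < s ω} := by
      ext ω
      simp only [Set.mem_iUnion, Set.mem_ofPred_eq]
      refine ⟨fun ⟨n, hn⟩ => by linarith [hupos n], fun hω => ?_⟩
      obtain ⟨n, hn⟩ := (hulim.eventually_lt_const (sub_pos.2 hω)).exists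
      exact ⟨n, by linarith⟩
    have hlim := tendsto_setIntegral_of_monotone (μ := P) (f := h)
      (s := fun n => {ω | sInf T + u n < s ω}) (fun n => measurableSet_lt measurable_const hs)
      (fun m n hmn ω hω => by
        have := hu.antitone hmn
        simp only [Set.mem_ofPred_eq] at hω ⊢
        linarith)
      hint.integrableOn
    rw [hU] at hlim
    refine le_of_tendsto' hlim fun n => ?_
    obtain ⟨c, hc, hcn⟩ := exists_lt_of_csInf_lt hne (lt_add_of_pos_right (sInf T) (hupos n))
    exact (hFanti hcn.le).trans hc
  -- Continuity from above: levels under the infimum lie outside `T`, so their tails have mass more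
  -- than 1.
  · have hU : (⋂ n, {ω | sInf T - u n < s ω}) = {ω | sInf T ≤ s ω} := by
      ext ω
      simp only [Set.mem_iInter, Set.mem_ofPred_eq]
      refine ⟨fun hω => ?_, fun hω n => by linarith [hupos n]⟩
      by_contra! hlt
      obtain ⟨n, hn⟩ := (hulim.eventually_lt_const (sub_pos.2 hlt)).exists
      linarith [hω n]
    have hlim := tendsto_setIntegral_of_antitone (μ := P) (f := h)
      (s := fun n => {ω | sInf T - u n < s ω}) (fun n => measurableSet_lt measurable_const hs)
      (fun m n hmn ω hω => by
        have := hu.antitone hmn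
        simp only [Set.mem_ofPred_eq] at hω ⊢
        linarith)
      ⟨0, hint.integrableOn⟩
    rw [hU] at hlim
    refine ge_of_tendsto' hlim fun n => ?_
    by_contra! hlt
    have : sInf T ≤ sInf T - u n := csInf_le hbdd hlt.le
    linarith [hupos n]

/-- Any weight of total mass at least one dominates a probability density concentrated on the
largest values of `s`. -/
theorem exists_density_upper_tail {h s : Ω → ℝ} (hint : Integrable h P)
    (h0 : ∀ᵐ ω ∂P, 0 ≤ h ω) (h1 : 1 ≤ ∫ ω, h ω ∂P) (hs : Measurable s)
    (hs0 : ∀ᵐ ω ∂P, 0 ≤ s ω) {M : ℝ} (hsM : ∀ᵐ ω ∂P, s ω ≤ M) :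
    ∃ (φ : Ω → ℝ) (c : ℝ), Integrable φ P ∧ (∀ᵐ ω ∂P, 0 ≤ φ ω) ∧ (∀ᵐ ω ∂P, φ ω ≤ h ω) ∧
      ∫ ω, φ ω ∂P = 1 ∧ ∀ᵐ ω ∂P, φ ω * (s ω - c) = h ω * max (s ω - c) 0 := by
  rcases h1.eq_or_lt with h1 | h1
  · refine ⟨h, 0, hint, h0, Eventually.of_forall fun _ => le_rfl, h1.symm, ?_⟩
    filter_upwards [hs0] with ω hω
    rw [sub_zero, max_eq_left hω]
  obtain ⟨c, hc1, hc2⟩ := exists_quantile hint h0 h1 hs hs0 hsM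
  set A : Set Ω := {ω | c < s ω} with hA
  set B : Set Ω := {ω | s ω = c} with hB
  have hAm : MeasurableSet A := measurableSet_lt measurable_const hs
  have hBm : MeasurableSet B := measurableSet_eq_fun hs measurable_const
  have hAB : {ω | c ≤ s ω} = A ∪ B := by
    ext ω
    simp only [hA, hB, Set.mem_union, Set.mem_ofPred_eq, le_iff_lt_or_eq, eq_comm]
  have hdisj : Disjoint A B := by
    rw [Set.disjoint_left]
    intro ω (h1 : c < s ω) (h2 : s ω = c)
    exact h1.ne' h2
  rw [hAB, setIntegral_union hdisj hBm hint.integrableOn hint.integrableOn] at hc2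
  set a := ∫ ω in A, h ω ∂P
  set b := ∫ ω in B, h ω ∂P
  have hb0 : 0 ≤ b := integral_nonneg_of_ae (ae_restrict_of_ae h0)
  -- The fraction of the level set `s = c` needed to reach mass 1. If `b = 0`, division by zero
  -- gives `t = 0`, harmless since then `a = 1`.
  set t := (1 - a) / b with ht
  have ht0 : 0 ≤ t := div_nonneg (sub_nonneg.2 hc1) hb0
  have ht1 : t ≤ 1 := div_le_one_of_le₀ (by linarith) hb0
  have htb : a + t * b = 1 := by
    rcases hb0.eq_or_lt with hb | hb
    · rw [← hb]; linarith
    · rw [ht, div_mul_cancel₀ _ hb.ne']; ring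
  refine ⟨fun ω => A.indicator h ω + B.indicator (fun ω => t * h ω) ω, c,
    (hint.indicator hAm).add ((hint.const_mul t).indicator hBm), ?_, ?_, ?_, ?_⟩
  · filter_upwards [h0] with ω hω
    exact add_nonneg (Set.indicator_apply_nonneg fun _ => hω)
      (Set.indicator_apply_nonneg fun _ => mul_nonneg ht0 hω)
  · filter_upwards [h0] with ω hω
    rcases lt_trichotomy c (s ω) with h | h | h
    · simp [hA, hB, Set.indicator, h, h.ne']
    · simpa [hA, hB, Set.indicator, h] using mul_le_of_le_one_left hω ht1
    · simpa [hA, hB, Set.indicator, h.not_gt, h.ne] using hω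
  · rw [integral_add (hint.indicator hAm) ((hint.const_mul t).indicator hBm),
      integral_indicator hAm, integral_indicator hBm, integral_const_mul, htb]
  · filter_upwards with ω
    rcases lt_trichotomy c (s ω) with h | h | h
    · simp [hA, hB, Set.indicator, h, h.ne', h.le]
    · simp [h]
    · simp [hA, hB, Set.indicator, h.not_gt, h.ne, h.le]

end Quantile

/-! ### A lower bound for ρ^H. -/

section RhoH

variable {Ω : Type*} [MeasurableSpace Ω] {P : Measure Ω}

/-- The upper-tail density φ satisfies φ(s - c) = H(s - c)⁺; integrating, E[φ s] = c + E[H(s - c)⁺],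
and φ competes in the supremum. -/
theorem exists_add_integral_le_rhoH {H : Lp ℝ 1 P} (hH : 0 ≤ H) (hH1 : 1 ≤ ∫ ω, H ω ∂P)
    {s : Lp ℝ ∞ P} (hs : 0 ≤ s) :
    ∃ c : ℝ, c + ∫ ω, H ω * max (s ω - c) 0 ∂P ≤ rhoH P H (-s) := by
  obtain ⟨φ, c, hφi, hφ0, hφH, hφ1, hφ⟩ := exists_density_upper_tail (L1.integrable_coeFn H)
    ((Lp.coeFn_nonneg H).2 hH) hH1 (Lp.stronglyMeasurable s).measurable ((Lp.coeFn_nonneg s).2 hs)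
    ((ae_abs_le_norm s).mono fun ω h => (le_abs_self _).trans h)
  have hcoe := hφi.coeFn_toL1
  have hmem : hφi.toL1 φ ∈ scenarioSetOf P H := by
    refine ⟨⟨?_, ?_⟩, ?_⟩
    · rw [← Lp.coeFn_nonneg]
      filter_upwards [hcoe, hφ0] with ω h1 h2
      rwa [h1]
    · rw [integral_congr_ae hcoe, hφ1]
    · rw [← Lp.coeFn_le]
      filter_upwards [hcoe, hφH] with ω h1 h2
      rwa [h1]
  refine ⟨c, le_trans (le_of_eq ?_) (le_worstCase (scenarioSetOf_subset H) hmem (-s))⟩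
  have hi := integrable_coe_mul (hφi.toL1 φ) s
  have hφs : ∫ ω, hφi.toL1 φ ω * (-(-s : Lp ℝ ∞ P) ω) ∂P = ∫ ω, hφi.toL1 φ ω * s ω ∂P := by
    refine integral_congr_ae ?_
    filter_upwards [Lp.coeFn_neg s] with ω h
    rw [h, Pi.neg_apply, neg_neg]
  have hHs : ∫ ω, H ω * max (s ω - c) 0 ∂P = ∫ ω, (hφi.toL1 φ ω * s ω - φ ω * c) ∂P := by
    refine integral_congr_ae ?_
    filter_upwards [hφ, hcoe] with ω h1 h2
    rw [← h1, h2, mul_sub]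
  rw [hφs, hHs, integral_sub hi (hφi.mul_const c), integral_mul_const, hφ1]
  ring

end RhoH

/-! ### The payoff rule, pointwise. -/

section Payoff

/-- The payoff to a unit with liability `x` when the total liability is `s`, the capital is `m`
and the surplus is shared with weight `w`. -/
noncomputable def payoff (m w s x : ℝ) : ℝ := if m < s then x / s * m else x + w * (m - s)

/-- The net loss of a unit in default. -/
noncomputable def defaultLoss (m s x : ℝ) : ℝ := if m < s then x * (1 - m / s) else 0

theorem payoff_nonneg {m w s x : ℝ} (hm : 0 ≤ m) (hw : 0 ≤ w) (hs : 0 ≤ s) (hx : 0 ≤ x) :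
    0 ≤ payoff m w s x := by
  unfold payoff
  split_ifs with h
  · positivity
  · exact add_nonneg hx (mul_nonneg hw (by linarith))

theorem sum_payoff {N : ℕ} {m : ℝ} (hm : 0 ≤ m) {w x : Fin N → ℝ} (hw : ∑ i, w i = 1) :
    ∑ i, payoff m (w i) (∑ j, x j) (x i) = m := by
  unfold payoff
  split_ifs with h
  · rw [← Finset.sum_mul, ← Finset.sum_div, div_self (hm.trans_lt h).ne', one_mul]
  · rw [Finset.sum_add_distrib, ← Finset.sum_mul, hw]
    ring

theorem defaultLoss_nonneg {m s x : ℝ} (hm : 0 ≤ m) (hx : 0 ≤ x) : 0 ≤ defaultLoss m s x := by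
  unfold defaultLoss
  split_ifs with h
  · exact mul_nonneg hx (sub_nonneg.2 (div_le_one_of_le₀ h.le (hm.trans h.le)))
  · exact le_rfl

theorem defaultLoss_le {m s x : ℝ} (hm : 0 ≤ m) (hx : 0 ≤ x) : defaultLoss m s x ≤ x := by
  unfold defaultLoss
  split_ifs with h
  · exact mul_le_of_le_one_right hx (sub_le_self _ (div_nonneg hm (hm.trans h.le)))
  · exact hx

theorem sum_defaultLoss {N : ℕ} {m : ℝ} (hm : 0 ≤ m) {x : Fin N → ℝ} :
    ∑ i, defaultLoss m (∑ j, x j) (x i) = max (∑ j, x j - m) 0 := by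
  unfold defaultLoss
  split_ifs with h
  · rw [← Finset.sum_mul, max_eq_left (by linarith), mul_sub, mul_one,
      mul_div_cancel₀ _ (hm.trans_lt h).ne']
  · rw [Finset.sum_const_zero, max_eq_right (by linarith)]

/-- Supplies the dominating function for `rhoH_nonpos`. The bound is an equality in default;
otherwise it reduces to w(s - c) ≤ w(s - c)⁺. -/
theorem sub_payoff_le {m w s x c : ℝ} (hm : 0 ≤ m) (hw : 0 ≤ w) (hx : 0 ≤ x) (hc : c ≤ m) :
    0 ≤ defaultLoss m s x + w * (max (s - c) 0 - max (s - m) 0) ∧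
    x - payoff m w s x + w * (m - c) ≤
      defaultLoss m s x + w * (max (s - c) 0 - max (s - m) 0) := by
  have h1 : max (s - m) 0 ≤ max (s - c) 0 := max_le_max (by linarith) le_rfl
  refine ⟨add_nonneg (defaultLoss_nonneg hm hx) (mul_nonneg hw (by linarith)), ?_⟩
  unfold payoff defaultLoss
  split_ifs with h
  · rw [max_eq_left (by linarith), max_eq_left (by linarith)]
    exact le_of_eq (by ring)
  · rw [max_eq_right (by linarith : s - m ≤ 0)]
    nlinarith [le_max_left (s - c) 0]

theorem measurable_payoff {Ω : Type*} [MeasurableSpace Ω] (m w : ℝ) {s x : Ω → ℝ}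
    (hs : Measurable s) (hx : Measurable x) : Measurable fun ω => payoff m w (s ω) (x ω) := by
  unfold payoff
  exact Measurable.ite (measurableSet_lt measurable_const hs) (by fun_prop) (by fun_prop)

theorem measurable_defaultLoss {Ω : Type*} [MeasurableSpace Ω] (m : ℝ) {s x : Ω → ℝ}
    (hs : Measurable s) (hx : Measurable x) : Measurable fun ω => defaultLoss m (s ω) (x ω) := by
  unfold defaultLoss
  exact Measurable.ite (measurableSet_lt measurable_const hs) (by fun_prop) (by fun_prop)

/-- Normalisation by the total; when everything vanishes, equal weights serve. -/
theorem exists_weights {N : ℕ} (hN : 0 < N) {a : Fin N → ℝ} (ha : ∀ i, 0 ≤ a i) :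
    ∃ w : Fin N → ℝ, (∀ i, 0 ≤ w i) ∧ ∑ i, w i = 1 ∧ ∀ i, a i = w i * ∑ j, a j := by
  have h0 : 0 ≤ ∑ j, a j := Finset.sum_nonneg fun i _ => ha i
  by_cases h : ∑ j, a j = 0
  · refine ⟨fun _ => 1 / N, fun _ => by positivity, ?_, fun i => ?_⟩
    · have : (N : ℝ) ≠ 0 := by positivity
      simp [this]
    · rw [h, mul_zero, (Finset.sum_eq_zero_iff_of_nonneg fun i _ => ha i).1 h i (Finset.mem_univ _)]
  · refine ⟨fun i => a i / ∑ j, a j, fun i => div_nonneg (ha i) h0, ?_, fun i => ?_⟩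
    · rw [← Finset.sum_div, div_self h]
    · rw [div_mul_cancel₀ _ h]

end Payoff

/-! ### ρ^H is cohesive. -/

section RhoH

variable {Ω : Type*} [MeasurableSpace Ω] {P : Measure Ω}

theorem nonempty_scenarioSetOf {H : Lp ℝ 1 P} (hH : 0 ≤ H) (hH1 : 1 ≤ ∫ ω, H ω ∂P) :
    (scenarioSetOf P H).Nonempty := by
  have hpos : 0 < ∫ ω, H ω ∂P := one_pos.trans_le hH1
  have hcoe := Lp.coeFn_smul (∫ ω, H ω ∂P)⁻¹ H
  have hH' := (Lp.coeFn_nonneg H).2 hH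
  refine ⟨(∫ ω, H ω ∂P)⁻¹ • H, ⟨?_, ?_⟩, ?_⟩
  · rw [← Lp.coeFn_nonneg]
    filter_upwards [hcoe, hH'] with ω h1 h2
    rw [h1]
    exact mul_nonneg (inv_nonneg.2 hpos.le) h2
  · rw [integral_congr_ae hcoe]
    simp only [Pi.smul_apply, smul_eq_mul]
    rw [integral_const_mul, inv_mul_cancel₀ hpos.ne']
  · rw [← Lp.coeFn_le]
    filter_upwards [hcoe, hH'] with ω h1 h2
    rw [h1]
    exact mul_le_of_le_one_left h2 (inv_le_one_of_one_le₀ hH1)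

/-- `E_Q[l] ≤ 0` for all `Q` in `S^H` if `l + d` is dominated by a nonnegative `g` with
`E[H g] ≤ d`. -/
theorem rhoH_nonpos {H : Lp ℝ 1 P} (hH : 0 ≤ H) (hH1 : 1 ≤ ∫ ω, H ω ∂P) {ξ : Lp ℝ ∞ P}
    {g : Ω → ℝ} {d : ℝ} (hgi : Integrable (fun ω => H ω * g ω) P)
    (hg : ∀ᵐ ω ∂P, 0 ≤ g ω ∧ -ξ ω + d ≤ g ω) (hgd : ∫ ω, H ω * g ω ∂P ≤ d) :
    rhoH P H ξ ≤ 0 := by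
  refine worstCase_le (nonempty_scenarioSetOf hH hH1) fun φ hφ => ?_
  have h1 : ∫ ω, (φ ω * (-ξ ω) + φ ω * d) ∂P ≤ ∫ ω, H ω * g ω ∂P := by
    refine integral_mono_ae
      ((integrable_coe_mul_neg φ ξ).add ((L1.integrable_coeFn φ).mul_const d)) hgi ?_
    filter_upwards [hg, densities.ae_nonneg hφ.1, (Lp.coeFn_le _ _).2 hφ.2] with ω h1 h2 h3
    rw [← mul_add]
    exact (mul_le_mul_of_nonneg_left h1.2 h2).trans (mul_le_mul_of_nonneg_right h3 h1.1)
  rw [integral_add (integrable_coe_mul_neg φ ξ) ((L1.integrable_coeFn φ).mul_const d),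
    integral_mul_const, hφ.1.2] at h1
  linarith

/-- The weights are chosen so that unit i's default loss has H-expectation w_i E[H(s - m)⁺]. This
cancels the subtracted term of the dominating function, leaving w_i E[H(s - c)⁺] ≤ w_i(m - c). -/
theorem isCohesive_rhoH [IsProbabilityMeasure P] {N : ℕ} (hN : 0 < N) {H : Lp ℝ 1 P} (hH : 0 ≤ H)
    (hH1 : 1 ≤ ∫ ω, H ω ∂P) (hρ : IsCoherent P (rhoH P H)) : IsCohesive P N (rhoH P H) := by
  refine ⟨hρ, fun X hX => ?_⟩
  set m := rhoH P H (-∑ i, X i) with hm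
  set s : Ω → ℝ := fun ω => ∑ i, X i ω with hs
  have hXm : ∀ i, Measurable (X i) := fun i => (Lp.stronglyMeasurable (X i)).measurable
  have hsm : Measurable s := Finset.measurable_fun_sum _ fun i _ => hXm i
  have hX0 : ∀ᵐ ω ∂P, ∀ i, 0 ≤ X i ω := ae_all_iff.2 fun i => (Lp.coeFn_nonneg _).2 (hX i)
  have hs0 : ∀ᵐ ω ∂P, 0 ≤ s ω := hX0.mono fun ω h => Finset.sum_nonneg fun i _ => h i
  have hsc : ∀ᵐ ω ∂P, (∑ i, X i : Lp ℝ ∞ P) ω = s ω := Lp.coeFn_fun_finsetSum _ _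
  have hm0 : 0 ≤ m := by
    rw [hm, ← hρ.map_zero]
    exact hρ.anti (neg_nonpos.2 (Finset.sum_nonneg fun i _ => hX i))
  obtain ⟨c, hc⟩ := exists_add_integral_le_rhoH hH hH1 (Finset.sum_nonneg fun i _ => hX i)
  have hHi := L1.integrable_coeFn H
  have hH0 : ∀ᵐ ω ∂P, 0 ≤ H ω := (Lp.coeFn_nonneg H).2 hH
  have hmul : ∀ {g : Ω → ℝ} (C : ℝ), Measurable g → (∀ᵐ ω ∂P, |g ω| ≤ C) →
      Integrable (fun ω => H ω * g ω) P := fun C hg hb =>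
    hHi.mul_bdd hg.aestronglyMeasurable hb
  have hXb : ∀ i, ∀ᵐ ω ∂P, |X i ω| ≤ ‖X i‖ := fun i => ae_abs_le_norm (X i)
  have hsb : ∀ᵐ ω ∂P, |s ω| ≤ ‖∑ i, X i‖ := by
    filter_upwards [ae_abs_le_norm (∑ i, X i), hsc] with ω h1 h2
    rwa [← h2]
  have hmax : ∀ d, Integrable (fun ω => H ω * max (s ω - d) 0) P := fun d => by
    refine hmul (‖∑ i, X i‖ + |d|) (by fun_prop) ?_
    filter_upwards [hsb] with ω h
    rw [abs_of_nonneg (le_max_right _ _)]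
    refine max_le ?_ (by positivity)
    linarith [le_abs_self (s ω), neg_abs_le d]
  have hdl : ∀ i, Integrable (fun ω => H ω * defaultLoss m (s ω) (X i ω)) P := fun i => by
    refine hmul ‖X i‖ (measurable_defaultLoss m hsm (hXm i)) ?_
    filter_upwards [hXb i, hX0] with ω h1 h2
    rw [abs_of_nonneg (defaultLoss_nonneg hm0 (h2 i))]
    exact (defaultLoss_le hm0 (h2 i)).trans ((le_abs_self _).trans h1)
  have hc' : c + ∫ ω, H ω * max (s ω - c) 0 ∂P ≤ m := by
    refine le_trans (le_of_eq ?_) hc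
    congr 1
    refine integral_congr_ae ?_
    filter_upwards [hsc] with ω h
    rw [h]
  have hcm : c ≤ m := by
    have : 0 ≤ ∫ ω, H ω * max (s ω - c) 0 ∂P := by
      refine integral_nonneg_of_ae ?_
      filter_upwards [hH0] with ω h
      exact mul_nonneg h (le_max_right _ _)
    linarith
  obtain ⟨w, hw0, hw1, hwa⟩ := exists_weights hN
    (a := fun i => ∫ ω, H ω * defaultLoss m (s ω) (X i ω) ∂P) fun i => by
      refine integral_nonneg_of_ae ?_
      filter_upwards [hH0, hX0] with ω h h'
      exact mul_nonneg h (defaultLoss_nonneg hm0 (h' i))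
  have hsum : ∑ i, ∫ ω, H ω * defaultLoss m (s ω) (X i ω) ∂P =
      ∫ ω, H ω * max (s ω - m) 0 ∂P := by
    rw [← integral_finsetSum _ fun i _ => hdl i]
    refine integral_congr_ae (Eventually.of_forall fun ω => ?_)
    simp only [← Finset.mul_sum, hs, sum_defaultLoss hm0]
  rw [hsum] at hwa
  have hpay0 : ∀ᵐ ω ∂P, ∀ i, 0 ≤ payoff m (w i) (s ω) (X i ω) := by
    filter_upwards [hs0, hX0] with ω h1 h2 i
    exact payoff_nonneg hm0 (hw0 i) h1 (h2 i)
  have hpays : ∀ ω, ∑ i, payoff m (w i) (s ω) (X i ω) = m := fun ω => sum_payoff hm0 hw1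
  have hpayL : ∀ i, MemLp (fun ω => payoff m (w i) (s ω) (X i ω)) ∞ P := fun i => by
    refine memLp_top_of_bound (measurable_payoff m (w i) hsm (hXm i)).aestronglyMeasurable m ?_
    filter_upwards [hpay0] with ω h
    rw [Real.norm_of_nonneg (h i)]
    exact (Finset.single_le_sum (fun j _ => h j) (Finset.mem_univ i)).trans_eq (hpays ω)
  have hcoe : ∀ᵐ ω ∂P, ∀ i, (hpayL i).toLp _ ω = payoff m (w i) (s ω) (X i ω) :=
    ae_all_iff.2 fun i => (hpayL i).coeFn_toLp
  refine ⟨fun i => (hpayL i).toLp _, ⟨fun i => ?_, ?_, fun i => ?_⟩, fun i => ?_⟩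
  · rw [← Lp.coeFn_nonneg]
    filter_upwards [hcoe, hpay0] with ω h1 h2
    rw [h1]
    exact h2 i
  · refine Lp.ext ?_
    filter_upwards [Lp.coeFn_fun_finsetSum Finset.univ fun i => (hpayL i).toLp _,
      Lp.coeFn_const ∞ P m, hcoe] with ω h1 h2 h3
    rw [h1, h2, Function.const_apply]
    exact (Finset.sum_congr rfl fun i _ => h3 i).trans (hpays ω)
  · filter_upwards [hcoe] with ω h
    rw [h]
    change (m < s ω → payoff m (w i) (s ω) (X i ω) = X i ω / s ω * m) ∧
      (s ω ≤ m → X i ω ≤ payoff m (w i) (s ω) (X i ω))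
    unfold payoff
    refine ⟨fun h => if_pos h, fun h => ?_⟩
    rw [if_neg h.not_gt]
    exact le_add_of_nonneg_right (mul_nonneg (hw0 i) (sub_nonneg.2 h))
  · have hgi : ∀ ω, H ω * (defaultLoss m (s ω) (X i ω) +
        w i * (max (s ω - c) 0 - max (s ω - m) 0)) = H ω * defaultLoss m (s ω) (X i ω) +
        w i * (H ω * max (s ω - c) 0 - H ω * max (s ω - m) 0) := fun ω => by ring
    have hi : Integrable (fun ω => w i * (H ω * max (s ω - c) 0 - H ω * max (s ω - m) 0)) P :=
      ((hmax c).sub (hmax m)).const_mul _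
    refine rhoH_nonpos hH hH1 (d := w i * (m - c))
      (g := fun ω => defaultLoss m (s ω) (X i ω) +
        w i * (max (s ω - c) 0 - max (s ω - m) 0)) ?_ ?_ ?_
    · simp only [hgi]
      exact (hdl i).add hi
    · filter_upwards [hcoe, hX0, Lp.coeFn_sub ((hpayL i).toLp _) (X i)] with ω h1 h2 h3
      rw [h3, Pi.sub_apply, h1, neg_sub]
      exact sub_payoff_le hm0 (hw0 i) (h2 i) hcm
    · simp only [hgi]
      rw [integral_add (hdl i) hi, integral_const_mul, integral_sub (hmax c) (hmax m), hwa i,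
        ← mul_add]
      exact mul_le_mul_of_nonneg_left (by linarith) (hw0 i)

end RhoH

/-! ### The upper probability and weak compactness. -/

section Capacity

variable {Ω : Type*} [MeasurableSpace Ω] {P : Measure Ω}

/-- The upper probability `sup_{Q ∈ S} Q(A)` of an event. -/
noncomputable def capacity (S : Set (Lp ℝ 1 P)) (A : Set Ω) : ℝ :=
  sSup ((fun φ : Lp ℝ 1 P => ∫ ω in A, φ ω ∂P) '' S)

theorem densities.setIntegral_le_one {φ : Lp ℝ 1 P} (hφ : φ ∈ densities P) (A : Set Ω) :
    ∫ ω in A, φ ω ∂P ≤ 1 :=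
  (setIntegral_le_integral (L1.integrable_coeFn φ) (densities.ae_nonneg hφ)).trans_eq hφ.2

theorem densities.setIntegral_nonneg {φ : Lp ℝ 1 P} (hφ : φ ∈ densities P) (A : Set Ω) :
    0 ≤ ∫ ω in A, φ ω ∂P :=
  integral_nonneg_of_ae (ae_restrict_of_ae (densities.ae_nonneg hφ))

variable {S : Set (Lp ℝ 1 P)}

theorem setIntegral_le_capacity (hS : S ⊆ densities P) {φ : Lp ℝ 1 P} (hφ : φ ∈ S) (A : Set Ω) :
    ∫ ω in A, φ ω ∂P ≤ capacity S A := by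
  refine le_csSup ⟨1, ?_⟩ ⟨φ, hφ, rfl⟩
  rintro _ ⟨ψ, hψ, rfl⟩
  exact densities.setIntegral_le_one (hS hψ) A

theorem capacity_le (hS : S.Nonempty) {A : Set Ω} {c : ℝ}
    (h : ∀ φ ∈ S, ∫ ω in A, φ ω ∂P ≤ c) : capacity S A ≤ c :=
  csSup_le (hS.image _) (by rintro _ ⟨φ, hφ, rfl⟩; exact h φ hφ)

theorem capacity_nonneg (hS : S ⊆ densities P) (A : Set Ω) : 0 ≤ capacity S A := by
  refine Real.sSup_nonneg ?_
  rintro _ ⟨φ, hφ, rfl⟩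
  exact densities.setIntegral_nonneg (hS hφ) A

theorem one_le_capacity_univ (hS : S ⊆ densities P) (hne : S.Nonempty) :
    1 ≤ capacity S Set.univ := by
  obtain ⟨φ, hφ⟩ := hne
  have := setIntegral_le_capacity hS hφ Set.univ
  rwa [setIntegral_univ, (hS hφ).2] at this

theorem capacity_mono (hS : S ⊆ densities P) (hne : S.Nonempty) {A B : Set Ω} (h : A ⊆ B) :
    capacity S A ≤ capacity S B :=
  capacity_le hne fun φ hφ => (setIntegral_mono_set (L1.integrable_coeFn φ).integrableOn
    (ae_restrict_of_ae (densities.ae_nonneg (hS hφ))) (Eventually.of_forall h)).trans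
      (setIntegral_le_capacity hS hφ B)

theorem capacity_union_le (hS : S ⊆ densities P) (hne : S.Nonempty) {A B : Set Ω}
    (hB : MeasurableSet B) (h : Disjoint A B) :
    capacity S (A ∪ B) ≤ capacity S A + capacity S B :=
  capacity_le hne fun φ hφ => by
    rw [setIntegral_union h hB (L1.integrable_coeFn φ).integrableOn
      (L1.integrable_coeFn φ).integrableOn]
    exact add_le_add (setIntegral_le_capacity hS hφ A) (setIntegral_le_capacity hS hφ B)

theorem continuous_setIntegral_toWeakSpace_symm (A : Set Ω) :
    Continuous fun x : WeakSpace ℝ (Lp ℝ 1 P) =>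
      ∫ ω in A, ((toWeakSpace ℝ (Lp ℝ 1 P)).symm x) ω ∂P := by
  let T : Lp ℝ 1 P →L[ℝ] ℝ :=
    { toFun := fun φ => ∫ ω in A, φ ω ∂P
      map_add' := fun φ ψ => by
        rw [integral_congr_ae (ae_restrict_of_ae (Lp.coeFn_add φ ψ))]
        exact integral_add (L1.integrable_coeFn φ).integrableOn (L1.integrable_coeFn ψ).integrableOn
      map_smul' := fun c φ => by
        rw [integral_congr_ae (ae_restrict_of_ae (Lp.coeFn_smul c φ))]
        exact integral_const_mul c _
      cont := continuous_setIntegral A }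
  exact WeakBilin.eval_continuous (topDualPairing ℝ (Lp ℝ 1 P)).flip T

theorem exists_setIntegral_eq_capacity (hne : S.Nonempty) (hSc : IsWeaklyCompact P S)
    (A : Set Ω) : ∃ φ ∈ S, ∫ ω in A, φ ω ∂P = capacity S A := by
  obtain ⟨_, ⟨φ, hφ, rfl⟩, hmax⟩ := IsCompact.exists_isMaxOn hSc (hne.image _)
    (continuous_setIntegral_toWeakSpace_symm A).continuousOn
  have hle : ∀ ψ ∈ S, ∫ ω in A, ψ ω ∂P ≤ ∫ ω in A, φ ω ∂P := fun ψ hψ => by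
    simpa using hmax ⟨ψ, hψ, rfl⟩
  refine ⟨φ, hφ, le_antisymm (le_csSup ⟨∫ ω in A, φ ω ∂P, ?_⟩ ⟨φ, hφ, rfl⟩) (capacity_le hne hle)⟩
  rintro _ ⟨ψ, hψ, rfl⟩
  exact hle ψ hψ

/-- A weakly compact set of densities has an upper probability that falls below one along
sequences of events decreasing to a null set. -/
theorem exists_capacity_lt_one (hS : S ⊆ densities P) (hne : S.Nonempty)
    (hSc : IsWeaklyCompact P S) {A : ℕ → Set Ω} (hA : ∀ n, MeasurableSet (A n))
    (hanti : Antitone A) (hnull : P (⋂ n, A n) = 0) : ∃ n, capacity S (A n) < 1 := by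
  by_contra! hcon
  have hcl : ∀ n, IsClosed {x : WeakSpace ℝ (Lp ℝ 1 P) |
      1 ≤ ∫ ω in A n, ((toWeakSpace ℝ (Lp ℝ 1 P)).symm x) ω ∂P} := fun n =>
    isClosed_le continuous_const (continuous_setIntegral_toWeakSpace_symm (A n))
  -- For finitely many indices, a maximiser on the smallest event meets all the constraints, so
  -- compactness yields one φ with mass at least 1 on every `A n`.
  obtain ⟨_, ⟨φ, hφ, rfl⟩, hall⟩ := IsCompact.inter_iInter_nonempty hSc _ hcl fun u => by
    obtain ⟨n, hn⟩ := u.exists_le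
    obtain ⟨φ, hφ, h⟩ := exists_setIntegral_eq_capacity hne hSc (A n)
    refine ⟨_, ⟨φ, hφ, rfl⟩, ?_⟩
    simp only [Set.mem_iInter, Set.mem_ofPred_eq, LinearEquiv.symm_apply_apply]
    intro i hi
    refine (hcon n).trans (h.symm.le.trans ?_)
    exact setIntegral_mono_set (L1.integrable_coeFn φ).integrableOn
      (ae_restrict_of_ae (densities.ae_nonneg (hS hφ))) (Eventually.of_forall (hanti (hn i hi)))
  simp only [Set.mem_iInter, Set.mem_ofPred_eq, LinearEquiv.symm_apply_apply] at hall
  have hlim := tendsto_setIntegral_of_antitone hA hanti ⟨0, (L1.integrable_coeFn φ).integrableOn⟩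
  rw [setIntegral_measure_zero _ hnull] at hlim
  exact absurd (ge_of_tendsto' hlim hall) (by norm_num)

end Capacity

/-! ### Construction of the dominating density by exhaustion. -/

section Dominating

variable {Ω : Type*} [MeasurableSpace Ω] {P : Measure Ω} {S : Set (Lp ℝ 1 P)}

/-- On the subsets of `U` the upper probability is the minimum of one and a measure with
integrable density. -/
def IsTruncatedOn (S : Set (Lp ℝ 1 P)) (U : Set Ω) : Prop :=
  ∃ h : Ω → ℝ, Integrable h P ∧ (∀ᵐ ω ∂P, 0 ≤ h ω) ∧ ∀ A ⊆ U, MeasurableSet A →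
    capacity S A ≤ ∫ ω in A, h ω ∂P ∧ (capacity S A < 1 → ∫ ω in A, h ω ∂P ≤ capacity S A)

/-- A maximiser φ on U is optimal on every A ⊆ U at once: c(A) + c(U \ A) ≤ c(U) = φ(A) + φ(U \ A),
and φ(U \ A) ≤ c(U \ A). -/
theorem isTruncatedOn_of_capacity_lt_one (hS : S ⊆ densities P) (hne : S.Nonempty)
    (hSc : IsWeaklyCompact P S)
    (hadd : ∀ A B, MeasurableSet A → MeasurableSet B → Disjoint A B → capacity S (A ∪ B) < 1 →
      capacity S A + capacity S B ≤ capacity S (A ∪ B))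
    {U : Set Ω} (hU : MeasurableSet U) (h1 : capacity S U < 1) : IsTruncatedOn S U := by
  obtain ⟨φ, hφ, hφU⟩ := exists_setIntegral_eq_capacity hne hSc U
  refine ⟨φ, L1.integrable_coeFn φ, densities.ae_nonneg (hS hφ), fun A hAU hA => ⟨?_, fun _ =>
    setIntegral_le_capacity hS hφ A⟩⟩
  have hun : A ∪ U \ A = U := Set.union_sdiff_cancel hAU
  have hsup := hadd A (U \ A) hA (hU.diff hA) Set.disjoint_sdiff_right (by rwa [hun])
  have hint : ∫ ω in U, φ ω ∂P = ∫ ω in A, φ ω ∂P + ∫ ω in U \ A, φ ω ∂P := by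
    rw [← setIntegral_union Set.disjoint_sdiff_right (hU.diff hA)
      (L1.integrable_coeFn φ).integrableOn (L1.integrable_coeFn φ).integrableOn, hun]
  rw [hun] at hsup
  linarith [setIntegral_le_capacity hS hφ (U \ A)]

/-- Glue the two densities along U. Subadditivity of c gives the upper bound on c, and `hadd` the
reverse one, since a capacity below 1 is inherited by both pieces. -/
theorem IsTruncatedOn.union (hS : S ⊆ densities P) (hne : S.Nonempty)
    (hadd : ∀ A B, MeasurableSet A → MeasurableSet B → Disjoint A B → capacity S (A ∪ B) < 1 →
      capacity S A + capacity S B ≤ capacity S (A ∪ B))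
    {U V : Set Ω} (hU : MeasurableSet U) (hUt : IsTruncatedOn S U) (hVt : IsTruncatedOn S V) :
    IsTruncatedOn S (U ∪ V) := by
  classical
  obtain ⟨g, hgi, hg0, hg⟩ := hUt
  obtain ⟨k, hki, hk0, hk⟩ := hVt
  refine ⟨U.indicator g + Uᶜ.indicator k, (hgi.indicator hU).add (hki.indicator hU.compl), ?_,
    fun A hA hAm => ?_⟩
  · filter_upwards [hg0, hk0] with ω h1 h2
    exact add_nonneg (Set.indicator_apply_nonneg fun _ => h1)
      (Set.indicator_apply_nonneg fun _ => h2)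
  have hint : ∫ ω in A, (U.indicator g + Uᶜ.indicator k) ω ∂P =
      ∫ ω in A ∩ U, g ω ∂P + ∫ ω in A ∩ Uᶜ, k ω ∂P := by
    simp only [Pi.add_apply]
    rw [integral_add (hgi.indicator hU).integrableOn (hki.indicator hU.compl).integrableOn,
      setIntegral_indicator hU, setIntegral_indicator hU.compl]
  have hun : A ∩ U ∪ A ∩ Uᶜ = A := Set.inter_union_compl A U
  have hdisj : Disjoint (A ∩ U) (A ∩ Uᶜ) :=
    disjoint_compl_right.mono Set.inter_subset_right Set.inter_subset_right
  have h1 := hg (A ∩ U) Set.inter_subset_right (hAm.inter hU)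
  have h2 := hk (A ∩ Uᶜ) (fun ω hω => (hA hω.1).resolve_left hω.2) (hAm.inter hU.compl)
  rw [hint]
  refine ⟨?_, fun hlt => ?_⟩
  · have := capacity_union_le hS hne (hAm.inter hU.compl) hdisj
    rw [hun] at this
    linarith [h1.1, h2.1]
  · have hsup := hadd _ _ (hAm.inter hU) (hAm.inter hU.compl) hdisj (by rwa [hun])
    rw [hun] at hsup
    have h3 := h1.2 ((capacity_mono hS hne Set.inter_subset_left).trans_lt hlt)
    have h4 := h2.2 ((capacity_mono hS hne Set.inter_subset_left).trans_lt hlt)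
    linarith

theorem Atomless.exists_subset_le_half [IsFiniteMeasure P] (hP : Atomless P) {A : Set Ω}
    (hA : MeasurableSet A) (h0 : 0 < P A) :
    ∃ B, MeasurableSet B ∧ B ⊆ A ∧ 0 < P B ∧ P B ≤ P A / 2 := by
  obtain ⟨B, hB, hBA, hB0, hlt⟩ := hP A hA h0
  rcases le_total (P B) (P A / 2) with h | h
  · exact ⟨B, hB, hBA, hB0, h⟩
  · refine ⟨A \ B, hA.diff hB, Set.sdiff_subset, ?_, ?_⟩
    · rw [measure_sdiff hBA hB.nullMeasurableSet (measure_ne_top P B)]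
      exact tsub_pos_of_lt hlt
    · rw [measure_sdiff hBA hB.nullMeasurableSet (measure_ne_top P B)]
      refine tsub_le_iff_right.2 ?_
      calc P A = P A / 2 + P A / 2 := (ENNReal.add_halves _).symm
        _ ≤ P A / 2 + P B := by gcongr

/-- Repeated halving produces events decreasing to a null set. -/
theorem Atomless.exists_subset_capacity_lt_one [IsFiniteMeasure P] (hP : Atomless P)
    (hS : S ⊆ densities P) (hne : S.Nonempty) (hSc : IsWeaklyCompact P S) {A : Set Ω}
    (hA : MeasurableSet A) (h0 : 0 < P A) :
    ∃ B, MeasurableSet B ∧ B ⊆ A ∧ 0 < P B ∧ capacity S B < 1 := by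
  choose f hfm hfs hf0 hfle using fun B : {B : Set Ω // MeasurableSet B ∧ 0 < P B} =>
    hP.exists_subset_le_half B.2.1 B.2.2
  let u : ℕ → {B : Set Ω // MeasurableSet B ∧ 0 < P B} := fun n =>
    (fun B => ⟨f B, hfm B, hf0 B⟩)^[n] ⟨A, hA, h0⟩
  have hsucc : ∀ n, (u (n + 1)).1 = f (u n) := fun n => by
    simp only [u, Function.iterate_succ_apply']
  have hanti : Antitone fun n => (u n).1 := antitone_nat_of_succ_le fun n => by
    rw [hsucc]
    exact hfs _
  have hbound : ∀ n, P (u n).1 ≤ P A * (2⁻¹) ^ n := fun n => by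
    induction n with
    | zero => simp [u]
    | succ n ih =>
      rw [hsucc, pow_succ, ← mul_assoc, ← div_eq_mul_inv]
      exact (hfle _).trans (ENNReal.div_le_div_right ih 2)
  have hnull : P (⋂ n, (u n).1) = 0 := by
    have hlim : Tendsto (fun n : ℕ => P A * (2⁻¹) ^ n) atTop (𝓝 0) := by
      simpa using ENNReal.Tendsto.const_mul
        (ENNReal.tendsto_pow_atTop_nhds_zero_of_lt_one ENNReal.one_half_lt_one)
        (Or.inr (measure_ne_top P A))
    exact le_antisymm (ge_of_tendsto' hlim fun n =>
      (measure_mono (Set.iInter_subset _ n)).trans (hbound n)) zero_le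
  obtain ⟨n, hn⟩ := exists_capacity_lt_one hS hne hSc (fun n => (u n).2.1) hanti hnull
  exact ⟨u n, (u n).2.1, hanti (Nat.zero_le n), (u n).2.2, hn⟩

theorem Atomless.isTruncatedOn_univ [IsFiniteMeasure P] (hP : Atomless P)
    (hS : S ⊆ densities P) (hne : S.Nonempty) (hSc : IsWeaklyCompact P S)
    (hadd : ∀ A B, MeasurableSet A → MeasurableSet B → Disjoint A B → capacity S (A ∪ B) < 1 →
      capacity S A + capacity S B ≤ capacity S (A ∪ B)) :
    IsTruncatedOn S Set.univ := by
  have hsmall := @isTruncatedOn_of_capacity_lt_one Ω _ P S hS hne hSc hadd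
  set G : Set ℝ≥0∞ := P '' {U | MeasurableSet U ∧ IsTruncatedOn S U} with hG
  have hle : ∀ U, MeasurableSet U → IsTruncatedOn S U → P U ≤ sSup G := fun U hU hUt =>
    le_sSup ⟨U, ⟨hU, hUt⟩, rfl⟩
  have hfin : sSup G ≠ ∞ := by
    refine ((sSup_le ?_).trans_lt (measure_lt_top P Set.univ)).ne
    rintro _ ⟨U, -, rfl⟩
    exact measure_mono (Set.subset_univ U)
  have hGne : G.Nonempty := by
    have h0 : capacity S (∅ : Set Ω) < 1 :=
      (capacity_le hne fun φ _ => by rw [setIntegral_empty]).trans_lt one_pos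
    exact ⟨_, ∅, ⟨MeasurableSet.empty, hsmall MeasurableSet.empty h0⟩, rfl⟩
  obtain ⟨p, -, hplim, hpG⟩ := exists_seq_tendsto_sSup hGne (OrderTop.bddAbove G)
  choose U hU hUp using hpG
  set V : ℕ → Set Ω := fun n => partialSups U n with hV
  have hVt : ∀ n, MeasurableSet (V n) ∧ IsTruncatedOn S (V n) := fun n => by
    induction n with
    | zero => simpa [hV] using hU 0
    | succ n ih =>
      simp only [hV, partialSups_add_one]
      exact ⟨ih.1.union (hU _).1, IsTruncatedOn.union hS hne hadd ih.1 ih.2 (hU _).2⟩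
  have hUV : ∀ n, U n ⊆ V n := fun n => le_partialSups U n
  -- Otherwise a piece of positive probability and capacity below 1, disjoint from all `V n`, could
  -- be adjoined, exceeding the supremum.
  have hnull : P (⋂ n, (V n)ᶜ) = 0 := by
    by_contra hne0
    obtain ⟨D, hD, hDV, hD0, hD1⟩ := hP.exists_subset_capacity_lt_one hS hne hSc
      (MeasurableSet.iInter fun n => (hVt n).1.compl) (pos_iff_ne_zero.2 hne0)
    have hbound : ∀ n, p n + P D ≤ sSup G := fun n => by
      have hdisj : Disjoint (V n) D :=
        disjoint_compl_right.mono_right (hDV.trans (Set.iInter_subset _ n))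
      calc p n + P D = P (U n) + P D := by rw [hUp]
        _ ≤ P (V n) + P D := by gcongr; exact hUV n
        _ = P (V n ∪ D) := (measure_union hdisj hD).symm
        _ ≤ sSup G := hle _ ((hVt n).1.union hD)
          (IsTruncatedOn.union hS hne hadd (hVt n).1 (hVt n).2 (hsmall hD hD1))
    have := le_of_tendsto' (hplim.add_const (P D)) hbound
    exact absurd this (not_le.2 (ENNReal.lt_add_right hfin hD0.ne'))
  -- Finitely many pieces suffice, so the glued density stays integrable.
  obtain ⟨n, hn⟩ := exists_capacity_lt_one hS hne hSc (fun n => (hVt n).1.compl)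
    (fun i j hij => Set.compl_subset_compl.2 ((partialSups U).monotone hij)) hnull
  rw [← Set.union_compl_self (V n)]
  exact IsTruncatedOn.union hS hne hadd (hVt n).1 (hVt n).2 (hsmall (hVt n).1.compl hn)

end Dominating

/-! ### Indicators in L^∞. -/

section Event

variable {Ω : Type*} [MeasurableSpace Ω] {P : Measure Ω} [IsProbabilityMeasure P]

variable (P) in
/-- The indicator of an event, as an element of `L^∞`. -/
noncomputable abbrev event {A : Set Ω} (hA : MeasurableSet A) : Lp ℝ ∞ P :=
  indicatorConstLp ∞ hA (measure_ne_top P A) 1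

theorem IsScenarioSet.map_neg_event {ρ : Lp ℝ ∞ P → ℝ} {S : Set (Lp ℝ 1 P)}
    (hS : IsScenarioSet P ρ S) {A : Set Ω} (hA : MeasurableSet A) :
    ρ (-event P hA) = capacity S A := by
  rw [hS.eq_sup, worstCase, capacity]
  congr 1
  refine Set.image_congr fun φ _ => ?_
  rw [← integral_indicator hA]
  refine integral_congr_ae ?_
  filter_upwards [Lp.coeFn_neg (event P hA),
    indicatorConstLp_coeFn (p := ∞) (hs := hA) (hμs := measure_ne_top P A) (c := (1 : ℝ))]
    with ω h1 h2
  rw [h1, Pi.neg_apply, neg_neg, h2]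
  by_cases h : ω ∈ A <;> simp [h]

end Event

/-! ### Layer-cake comparison for commonotonic risk measures. -/

section Layers

/-- Layer-cake approximation of a number in `[0, K ε]` by a multiple of `ε`. -/
theorem layer_sum_bounds {ε y : ℝ} (hε : 0 < ε) (hy : 0 ≤ y) (K : ℕ) :
    (K * ε ≤ y → ε * ∑ j ∈ Finset.range K, (if (j + 1 : ℝ) * ε ≤ y then 1 else 0) = K * ε) ∧
    ε * ∑ j ∈ Finset.range K, (if (j + 1 : ℝ) * ε ≤ y then 1 else 0) ≤ y ∧
    (y ≤ K * ε →
      y ≤ ε * ∑ j ∈ Finset.range K, (if (j + 1 : ℝ) * ε ≤ y then 1 else 0) + ε) := by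
  induction K with
  | zero =>
    simp only [Finset.range_zero, Finset.sum_empty, CharP.cast_eq_zero, zero_mul, mul_zero]
    exact ⟨fun _ => trivial, hy, fun h => by linarith⟩
  | succ K ih =>
    obtain ⟨h1, h2, h3⟩ := ih
    simp only [Finset.sum_range_succ, mul_add]
    push_cast
    split_ifs with h
    -- The first conjunct serves the induction: reaching the top layer means all lower layers are
    -- full.
    · have hK := h1 (by linarith)
      refine ⟨fun _ => by rw [hK]; ring, by rw [hK]; linarith, fun hle => ?_⟩
      rw [hK]
      linarith
    · refine ⟨fun h' => absurd h' h, by linarith, fun _ => ?_⟩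
      rcases le_total y (K * ε) with h' | h'
      · linarith [h3 h']
      · rw [h1 h']
        linarith

theorem measurableSet_le_coe {Ω : Type*} [MeasurableSpace Ω] {P : Measure Ω} (η : Lp ℝ ∞ P)
    (c : ℝ) : MeasurableSet {ω | c ≤ η ω} :=
  measurableSet_le measurable_const (Lp.stronglyMeasurable η).measurable

variable {Ω : Type*} [MeasurableSpace Ω] {P : Measure Ω} [IsProbabilityMeasure P]
  {ρ : Lp ℝ ∞ P → ℝ} {S : Set (Lp ℝ 1 P)}

theorem ae_sum_event (η : Lp ℝ ∞ P) (c : ℕ → ℝ) (K : ℕ) :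
    ∀ᵐ ω ∂P, (∑ j ∈ Finset.range K, event P (measurableSet_le_coe η (c j)) : Lp ℝ ∞ P) ω =
      ∑ j ∈ Finset.range K, if c j ≤ η ω then (1 : ℝ) else 0 := by
  have h : ∀ᵐ ω ∂P, ∀ j, event P (measurableSet_le_coe η (c j)) ω =
      if c j ≤ η ω then (1 : ℝ) else 0 := ae_all_iff.2 fun j => by
    filter_upwards [indicatorConstLp_coeFn (p := ∞) (hs := measurableSet_le_coe η (c j))
      (hμs := measure_ne_top P _) (c := (1 : ℝ))] with ω hω
    rw [hω, Set.indicator_apply]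
    rfl
  filter_upwards [Lp.coeFn_fun_finsetSum (Finset.range K)
    fun j => event P (measurableSet_le_coe η (c j)), h] with ω h1 h2
  rw [h1]
  exact Finset.sum_congr rfl fun j _ => h2 j

theorem IsCommonotonic.map_neg_sum_event (hρ : IsCoherent P ρ) (hcom : IsCommonotonic P ρ)
    (hS : IsScenarioSet P ρ S) (η : Lp ℝ ∞ P) (c : ℕ → ℝ) (K : ℕ) :
    ρ (-∑ j ∈ Finset.range K, event P (measurableSet_le_coe η (c j))) =
      ∑ j ∈ Finset.range K, capacity S {ω | c j ≤ η ω} := by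
  induction K with
  | zero => simp [hρ.map_zero]
  | succ K ih =>
    rw [Finset.sum_range_succ, Finset.sum_range_succ, neg_add, hcom, ih, hS.map_neg_event]
    have hmono : ∀ a : ℝ, Monotone fun z : ℝ => -(if a ≤ -z then (1 : ℝ) else 0) := by
      intro a x y hxy
      dsimp only
      split_ifs <;> linarith
    -- Each -1_{c_j ≤ η} is a nondecreasing function of -η, so the partial sum and the next term are
    -- commonotonic.
    refine ⟨fun ω => -η ω, fun z => ∑ j ∈ Finset.range K, -(if c j ≤ -z then (1 : ℝ) else 0),
      fun z => -(if c K ≤ -z then (1 : ℝ) else 0), (Lp.stronglyMeasurable η).measurable.neg,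
      fun x y hxy => Finset.sum_le_sum fun j _ => hmono (c j) hxy, hmono (c K), ?_, ?_⟩
    · filter_upwards [ae_sum_event η c K,
        Lp.coeFn_neg (∑ j ∈ Finset.range K, event P (measurableSet_le_coe η (c j)))] with ω h1 h2
      rw [h2, Pi.neg_apply, h1, Finset.sum_neg_distrib]
      simp only [neg_neg]
    · filter_upwards [indicatorConstLp_coeFn (p := ∞) (hs := measurableSet_le_coe η (c K))
        (hμs := measure_ne_top P _) (c := (1 : ℝ)),
        Lp.coeFn_neg (event P (measurableSet_le_coe η (c K)))] with ω h1 h2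
      rw [h2, Pi.neg_apply, h1, neg_neg, Set.indicator_apply]
      rfl

/-- For a commonotonic risk measure, a density dominated by the upper probability on events is
dominated by the risk measure. -/
theorem IsCommonotonic.integral_mul_le_map_neg (hρ : IsCoherent P ρ) (hcom : IsCommonotonic P ρ)
    (hS : IsScenarioSet P ρ S) {φ : Lp ℝ 1 P} (hφ : φ ∈ densities P)
    (hφS : ∀ A, MeasurableSet A → ∫ ω in A, φ ω ∂P ≤ capacity S A) {η : Lp ℝ ∞ P} (hη : 0 ≤ η) :
    ∫ ω, φ ω * η ω ∂P ≤ ρ (-η) := by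
  refine le_of_forall_pos_le_add fun ε hε => ?_
  obtain ⟨K, hK⟩ := exists_nat_ge (‖η‖ / ε)
  rw [div_le_iff₀ hε] at hK
  set c : ℕ → ℝ := fun j => (j + 1) * ε with hc
  set T : Lp ℝ ∞ P := ∑ j ∈ Finset.range K, event P (measurableSet_le_coe η (c j)) with hT
  have hη0 : ∀ᵐ ω ∂P, 0 ≤ η ω := (Lp.coeFn_nonneg η).2 hη
  have hTη : ε • T ≤ η := by
    rw [← Lp.coeFn_le]
    filter_upwards [ae_sum_event η c K, Lp.coeFn_smul ε T, hη0] with ω h1 h2 h3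
    rw [h2, Pi.smul_apply, h1, smul_eq_mul]
    exact (layer_sum_bounds hε h3 K).2.1
  have hρT : ε * ∑ j ∈ Finset.range K, capacity S {ω | c j ≤ η ω} ≤ ρ (-η) := by
    rw [← hcom.map_neg_sum_event hρ hS, ← hρ.pos_homogeneous _ _ hε.le, smul_neg]
    exact hρ.anti (neg_le_neg hTη)
  have hφi := L1.integrable_coeFn φ
  have hlayer : ∀ j, Integrable ({ω | c j ≤ η ω}.indicator φ) P := fun j =>
    hφi.indicator (measurableSet_le_coe η (c j))
  have hmain : ∫ ω, φ ω * η ω ∂P ≤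
      ∫ ω, (ε * (∑ j ∈ Finset.range K, {ω | c j ≤ η ω}.indicator φ ω) + φ ω * ε) ∂P := by
    refine integral_mono_ae (integrable_coe_mul φ η)
      (((integrable_finsetSum _ fun j _ => hlayer j).const_mul ε).add (hφi.mul_const ε)) ?_
    filter_upwards [densities.ae_nonneg hφ, hη0, ae_abs_le_norm η] with ω h1 h2 h3
    have h4 := (layer_sum_bounds hε h2 K).2.2 (((le_abs_self _).trans h3).trans hK)
    refine (mul_le_mul_of_nonneg_left h4 h1).trans_eq ?_
    rw [mul_add, mul_left_comm, Finset.mul_sum]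
    congr 2
    refine Finset.sum_congr rfl fun j _ => ?_
    rw [mul_ite, mul_one, mul_zero, Set.indicator_apply]
    rfl
  rw [integral_add ((integrable_finsetSum _ fun j _ => hlayer j).const_mul ε) (hφi.mul_const ε),
    integral_const_mul, integral_finsetSum _ fun j _ => hlayer j, integral_mul_const, hφ.2,
    one_mul] at hmain
  refine hmain.trans (add_le_add_left ((mul_le_mul_of_nonneg_left
    (Finset.sum_le_sum fun j _ => ?_) hε.le).trans hρT) ε)
  rw [integral_indicator (measurableSet_le_coe η (c j))]
  exact hφS _ (measurableSet_le_coe η (c j))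

/-- Cash additivity reduces to the nonnegative variable ‖ξ‖ - ξ. -/
theorem IsCommonotonic.integral_mul_neg_le (hρ : IsCoherent P ρ) (hcom : IsCommonotonic P ρ)
    (hS : IsScenarioSet P ρ S) {φ : Lp ℝ 1 P} (hφ : φ ∈ densities P)
    (hφS : ∀ A, MeasurableSet A → ∫ ω in A, φ ω ∂P ≤ capacity S A) (ξ : Lp ℝ ∞ P) :
    ∫ ω, φ ω * (-ξ ω) ∂P ≤ ρ ξ := by
  set η : Lp ℝ ∞ P := Lp.const ∞ P ‖ξ‖ - ξ with hη
  have hcoe : ∀ᵐ ω ∂P, η ω = ‖ξ‖ - ξ ω := by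
    filter_upwards [Lp.coeFn_sub (Lp.const ∞ P ‖ξ‖) ξ, Lp.coeFn_const ∞ P ‖ξ‖] with ω h1 h2
    rw [h1, Pi.sub_apply, h2, Function.const_apply]
  have hη0 : 0 ≤ η := by
    rw [← Lp.coeFn_nonneg]
    filter_upwards [hcoe, ae_abs_le_norm ξ] with ω h1 h2
    rw [h1]
    exact sub_nonneg.2 ((le_abs_self _).trans h2)
  have hle := hcom.integral_mul_le_map_neg hρ hS hφ hφS hη0
  have hneg : ξ = -η + Lp.const ∞ P ‖ξ‖ := by rw [hη]; abel
  have hval : ∫ ω, φ ω * η ω ∂P = ∫ ω, φ ω * (-ξ ω) ∂P + ‖ξ‖ := by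
    have hi := (L1.integrable_coeFn φ).mul_const ‖ξ‖
    have : ∫ ω, φ ω * η ω ∂P = ∫ ω, (φ ω * (-ξ ω) + φ ω * ‖ξ‖) ∂P := by
      refine integral_congr_ae ?_
      filter_upwards [hcoe] with ω h
      rw [h]
      ring
    rw [this, integral_add (integrable_coe_mul_neg φ ξ) hi, integral_mul_const, hφ.2, one_mul]
  have hcash := hρ.cash_additive (-η) ‖ξ‖
  rw [← hneg] at hcash
  linarith

end Layers

/-! ### Additivity of the upper probability and the forward direction. -/

section Additivity

variable {Ω : Type*} [MeasurableSpace Ω] {P : Measure Ω} [IsProbabilityMeasure P]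
  {ρ : Lp ℝ ∞ P → ℝ} {S : Set (Lp ℝ 1 P)}

theorem ae_event {A : Set Ω} (hA : MeasurableSet A) :
    ∀ᵐ ω ∂P, event P hA ω = A.indicator (fun _ => (1 : ℝ)) ω := indicatorConstLp_coeFn

/-- The gain of a unit with liability `1_A` outside the default event `D`. -/
theorem IsCommonotonic.exists_gain (hρ : IsCoherent P ρ) (hcom : IsCommonotonic P ρ)
    (hS : IsScenarioSet P ρ S) {A D : Set Ω} (hA : MeasurableSet A) (hAD : A ⊆ D) {m : ℝ}
    (hm1 : m < 1) {Y : Lp ℝ ∞ P} (hY0 : 0 ≤ Y)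
    (hY : ∀ᵐ ω ∂P, ω ∈ D → Y ω = event P hA ω * m) (hacc : ρ (Y - event P hA) ≤ 0) :
    ∃ W : Lp ℝ ∞ P, (∀ᵐ ω ∂P, W ω = Dᶜ.indicator Y ω) ∧ ρ W + (1 - m) * capacity S A ≤ 0 := by
  set I := event P hA with hI
  -- Gain and loss are max(·, 0) and min(·, 0) of the net worth `Y - I`, hence commonotonic; on A
  -- the net worth is m - 1 < 0.
  have hW : ∀ᵐ ω ∂P, (Y - I + (1 - m) • I : Lp ℝ ∞ P) ω = Dᶜ.indicator Y ω ∧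
      (Y - I + (1 - m) • I : Lp ℝ ∞ P) ω = max ((Y - I : Lp ℝ ∞ P) ω) 0 ∧
      ((1 - m) • (-I) : Lp ℝ ∞ P) ω = min ((Y - I : Lp ℝ ∞ P) ω) 0 := by
    filter_upwards [Lp.coeFn_add (Y - I) ((1 - m) • I), Lp.coeFn_sub Y I,
      Lp.coeFn_smul (1 - m) I, Lp.coeFn_smul (1 - m) (-I), Lp.coeFn_neg I, ae_event hA, hY,
      (Lp.coeFn_nonneg Y).2 hY0] with ω h1 h2 h3 h4 h5 h6 h7 h8
    change 0 ≤ Y ω at h8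
    rw [h1, h4, Pi.add_apply, h3, h2, Pi.sub_apply, Pi.smul_apply, Pi.smul_apply, h5, Pi.neg_apply]
    rw [← hI] at h6
    rw [h6] at h7 ⊢
    simp only [smul_eq_mul]
    by_cases hωD : ω ∈ D
    · rw [h7 hωD]
      by_cases hωA : ω ∈ A
      · simp only [Set.indicator_of_mem hωA, Set.mem_compl_iff, hωD, not_true_eq_false,
          not_false_eq_true, Set.indicator_of_notMem]
        rw [max_eq_right (by linarith), min_eq_left (by linarith)]
        exact ⟨by ring, by ring, by ring⟩
      · simp [Set.indicator_of_notMem hωA, hωD]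
    · have hωA : ω ∉ A := fun h => hωD (hAD h)
      simp [Set.indicator_of_notMem hωA, hωD, h8]
  refine ⟨Y - I + (1 - m) • I, hW.mono fun ω h => h.1, ?_⟩
  have hadd := hcom (Y - I + (1 - m) • I) ((1 - m) • (-I))
    ⟨(Y - I : Lp ℝ ∞ P), fun z => max z 0, fun z => min z 0,
      (Lp.stronglyMeasurable _).measurable, fun _ _ h => max_le_max h le_rfl,
      fun _ _ h => min_le_min h le_rfl, hW.mono fun ω h => h.2.1, hW.mono fun ω h => h.2.2⟩
  rw [smul_neg, add_neg_cancel_right, ← smul_neg, hρ.pos_homogeneous _ _ (by linarith),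
    hI, hS.map_neg_event] at hadd
  linarith

theorem IsCohesive.capacity_add_le {N : ℕ} (hN : 2 ≤ N) (hcoh : IsCohesive P N ρ)
    (hcom : IsCommonotonic P ρ) (hS : IsScenarioSet P ρ S) {A B : Set Ω} (hA : MeasurableSet A)
    (hB : MeasurableSet B) (hdisj : Disjoint A B) (hlt : capacity S (A ∪ B) < 1) :
    capacity S A + capacity S B ≤ capacity S (A ∪ B) := by
  obtain ⟨hρ, hcoh⟩ := hcoh
  set m := capacity S (A ∪ B) with hm
  have hm0 : 0 ≤ m := capacity_nonneg hS.subset_densities _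
  have hD := hA.union hB
  let i : Fin N := ⟨0, by omega⟩
  let j : Fin N := ⟨1, by omega⟩
  have hij : i ≠ j := by simp [i, j]
  let X : Fin N → Lp ℝ ∞ P := Pi.single i (event P hA) + Pi.single j (event P hB)
  have hXi : X i = event P hA := by simp [X, hij]
  have hXj : X j = event P hB := by simp [X, hij.symm]
  have hpos : ∀ {C : Set Ω} (hC : MeasurableSet C), 0 ≤ event P hC := fun hC => by
    rw [← Lp.coeFn_nonneg]
    filter_upwards [ae_event hC] with ω h
    rw [h]
    exact Set.indicator_apply_nonneg fun _ => zero_le_one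
  have hX0 : 0 ≤ X :=
    add_nonneg (Pi.single_nonneg.2 (hpos hA)) (Pi.single_nonneg.2 (hpos hB))
  have hXsum : ∑ k, X k = event P hD := by
    simp only [X, Pi.add_apply, Finset.sum_add_distrib, Finset.sum_pi_single', Finset.mem_univ,
      if_true]
    exact (indicatorConstLp_disjoint_union hA hB (measure_ne_top P A) (measure_ne_top P B)
      hdisj 1).symm
  obtain ⟨Y, ⟨hY0, hYsum, hYX⟩, hacc⟩ := hcoh X hX0
  rw [hXsum, hS.map_neg_event hD, ← hm] at hYsum hYX
  have hXs : ∀ᵐ ω ∂P, ∑ k, X k ω = (A ∪ B).indicator (fun _ => (1 : ℝ)) ω := by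
    filter_upwards [Lp.coeFn_fun_finsetSum Finset.univ X, ae_event (P := P) hD] with ω h1 h2
    rw [← h1, hXsum, h2]
  -- On A ∪ B the total liability is 1 > m, so the group is in default.
  have hYD : ∀ k, ∀ᵐ ω ∂P, ω ∈ A ∪ B → Y k ω = X k ω * m := fun k => by
    filter_upwards [hYX k, hXs] with ω h1 h2 hω
    rw [Set.indicator_of_mem hω] at h2
    rw [h1.1 (by rwa [h2]), h2, div_one]
  obtain ⟨W, hW, hWle⟩ := hcom.exists_gain hρ hS hA (Set.subset_union_left (t := B)) hlt
    (hY0 i) (hXi ▸ hYD i) (hXi ▸ hacc i)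
  obtain ⟨Z, hZ, hZle⟩ := hcom.exists_gain hρ hS hB (Set.subset_union_right (s := A)) hlt
    (hY0 j) (hXj ▸ hYD j) (hXj ▸ hacc j)
  -- The right side is m times the indicator of the complement of A ∪ B; there the two gains are
  -- part of a total payoff m.
  have hWZ : W + Z ≤ m • (-event P hD) + Lp.const ∞ P m := by
    rw [← Lp.coeFn_le]
    filter_upwards [hW, hZ, Lp.coeFn_add W Z, Lp.coeFn_add (m • (-event P hD)) (Lp.const ∞ P m),
      Lp.coeFn_smul m (-event P hD), Lp.coeFn_neg (event P hD), ae_event (P := P) hD,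
      Lp.coeFn_const ∞ P m, Lp.coeFn_fun_finsetSum Finset.univ Y,
      ae_all_iff.2 fun k => (Lp.coeFn_nonneg (Y k)).2 (hY0 k)]
      with ω h1 h2 h3 h4 h5 h6 h7 h8 h9 h10
    rw [h3, h4, Pi.add_apply, Pi.add_apply, h1, h2, h5, Pi.smul_apply, h6, Pi.neg_apply, h7, h8,
      Function.const_apply, smul_eq_mul]
    rw [hYsum, h8, Function.const_apply] at h9
    by_cases hω : ω ∈ A ∪ B
    · rw [Set.indicator_of_mem hω, Set.indicator_of_notMem (Set.notMem_compl_iff.2 hω),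
        Set.indicator_of_notMem (Set.notMem_compl_iff.2 hω)]
      simp
    · rw [Set.indicator_of_mem (Set.mem_compl hω), Set.indicator_of_mem (Set.mem_compl hω),
        Set.indicator_of_notMem hω, ← Finset.sum_pair (f := fun k => Y k ω) hij, h9]
      simpa using Finset.sum_le_univ_sum_of_nonneg (f := fun k => Y k ω) (s := {i, j}) h10
  have h1 := hρ.anti hWZ
  rw [hρ.cash_additive, hρ.pos_homogeneous _ _ hm0, hS.map_neg_event hD, ← hm] at h1
  have h2 := hρ.map_add_le W Z
  -- Chain: (1 - m)(c(A) + c(B)) ≤ -ρ(W) - ρ(Z) ≤ -ρ(W + Z) ≤ m - m².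
  have h3 : (1 - m) * (capacity S A + capacity S B) ≤ (1 - m) * m := by linarith
  exact le_of_mul_le_mul_left h3 (by linarith)

theorem IsCohesive.exists_eq_rhoH {N : ℕ} (hN : 2 ≤ N) (hP : Atomless P)
    (hcoh : IsCohesive P N ρ) (hcom : IsCommonotonic P ρ) (hS : IsScenarioSet P ρ S)
    (hSc : IsWeaklyCompact P S) :
    ∃ H : Lp ℝ 1 P, 0 ≤ H ∧ 1 ≤ ∫ ω, H ω ∂P ∧ ρ = rhoH P H := by
  have hSd := hS.subset_densities
  obtain ⟨h, hi, h0, hh⟩ := hP.isTruncatedOn_univ hSd hS.nonempty hSc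
    fun A B hA hB hAB hlt => hcoh.capacity_add_le hN hcom hS hA hB hAB hlt
  have hcoe := hi.coeFn_toL1
  have hset : ∀ A, ∫ ω in A, hi.toL1 h ω ∂P = ∫ ω in A, h ω ∂P := fun A =>
    integral_congr_ae (ae_restrict_of_ae hcoe)
  have hcap : ∀ A, MeasurableSet A → capacity S A ≤ ∫ ω in A, hi.toL1 h ω ∂P ∧
      (capacity S A < 1 → ∫ ω in A, hi.toL1 h ω ∂P ≤ capacity S A) := fun A hA => by
    rw [hset]
    exact hh A (Set.subset_univ A) hA
  have hH0 : 0 ≤ hi.toL1 h := by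
    rw [← Lp.coeFn_nonneg]
    filter_upwards [hcoe, h0] with ω h1 h2
    rwa [h1]
  have hH1 : 1 ≤ ∫ ω, hi.toL1 h ω ∂P := by
    rw [← setIntegral_univ]
    exact (one_le_capacity_univ hSd hS.nonempty).trans (hcap _ MeasurableSet.univ).1
  refine ⟨hi.toL1 h, hH0, hH1, funext fun ξ => le_antisymm ?_ ?_⟩
  · rw [hS.eq_sup]
    refine worstCase_le hS.nonempty fun φ hφ => le_worstCase (scenarioSetOf_subset _) ⟨hSd hφ, ?_⟩ ξ
    rw [← Lp.coeFn_le]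
    exact ae_le_of_forall_setIntegral_le (L1.integrable_coeFn φ) (L1.integrable_coeFn _)
      fun A hA _ => (setIntegral_le_capacity hSd hφ A).trans (hcap A hA).1
  · refine worstCase_le (nonempty_scenarioSetOf hH0 hH1) fun φ hφ =>
      hcom.integral_mul_neg_le hcoh.1 hS hφ.1 (fun A hA => ?_) ξ
    -- The truncation at 1 costs nothing, since φ is a probability density.
    rcases lt_or_ge (capacity S A) 1 with hlt | hge
    · refine le_trans ?_ ((hcap A hA).2 hlt)
      exact integral_mono_ae (L1.integrable_coeFn φ).integrableOn
        (L1.integrable_coeFn _).integrableOn (ae_restrict_of_ae ((Lp.coeFn_le _ _).2 hφ.2))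
    · exact (densities.setIntegral_le_one hφ.1 A).trans hge

end Additivity

end CohesiveRisk

theorem mainTheorem1 {Ω : Type*} [MeasurableSpace Ω] (P : Measure Ω) [IsProbabilityMeasure P]
    (hP : CohesiveRisk.Atomless P) (N : ℕ) (hN : 2 ≤ N)
    (ρ : Lp ℝ ∞ P → ℝ) (hρ : CohesiveRisk.IsCoherent P ρ)
    (hcom : CohesiveRisk.IsCommonotonic P ρ)
    (S : Set (Lp ℝ 1 P)) (hS : CohesiveRisk.IsScenarioSet P ρ S)
    (hSc : CohesiveRisk.IsWeaklyCompact P S) :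
    CohesiveRisk.IsCohesive P N ρ ↔
      ∃ H : Lp ℝ 1 P, 0 ≤ H ∧ 1 ≤ ∫ ω, H ω ∂P ∧ ρ = CohesiveRisk.rhoH P H := by
  refine ⟨fun hcoh => hcoh.exists_eq_rhoH hN hP hcom hS hSc, ?_⟩
  rintro ⟨H, hH0, hH1, rfl⟩
  exact CohesiveRisk.isCohesive_rhoH (by omega) hH0 hH1 hρ
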